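/- **Inference systems with corules.** An inference system on a set of judgements is a set of rules, i.e. pairs (set of premises, conclusion). Let $\mathcal I$ and $\mathcal K$ be inference systems on the same set of judgements. $\mathrm{Ind}(\mathcal I)$ is the set of judgements with a well-founded proof tree in $\mathcal I$. $\mathrm{CoInd}(\mathcal I)$ is the set of judgements with an arbitrary proof tree in $\mathcal I$; equivalently, it is the largest set each of whose members is the conclusion of a rule of $\mathcal I$ with all premises in the set. A judgement is *derivable in* $(\mathcal I,\mathcal K)$ ($\mathcal I$ the rules, $\mathcal K$ the corules) if it lies in $\mathrm{CoInd}(\mathcal I')$, where $\mathcal I'$ consists of the rules of $\mathcal I$ whose conclusion lies in $\mathrm{Ind}(\mathcal I\cup\mathcal K)$. **Big-step semantics.** A big-step semantics $(C,R,\mathcal R)$ consists of a set $C$ of configurations, a set $R$ of results, and a set $\mathcal R$ of rules $\rho$ with a finite sequence of premises $c_1\Rightarrow r_1,\dots,c_n\Rightarrow r_n$ ($n\ge 0$) and a conclusion $c\Rightarrow r$ ($c,c_i\in C$, $r,r_i\in R$). It is required that for every $c\in C$ there is $b_c\in\mathbb N$ such that every rule with configuration $c$ in its conclusion has at most $b_c$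 premises. When a set of big-step rules is used as an inference system, the order and multiplicity of premises are forgotten. For two rules $\rho,\rho'$ and an index $i$ not exceeding the number of premises of either, $\rho\sim_i\rho'$ means that their conclusions have the same configuration, their premises before the $i$-th coincide, and their $i$-th premises have the same configuration. **Total semantics.** Its judgements are $c\Rightarrow x$ with $c\in C$ and $x\in R\cup\{\mathsf{wrong},\infty\}$ (disjoint union). Its rules $\mathcal R_{\mathrm{tot}}$ are the rules in $\mathcal R$ together with: * *wrong configuration rules*: the axiom $c\Rightarrow\mathsf{wrong}$, for each $c\in C$ that is not the configuration in the conclusion of any rule of $\mathcal R$; * *wrong result rules*: for $\rho\in\mathcal R$ as above, $1\le i\le n$ and $r'\in R$ such that no $\rho'\in\mathcal R$ with $\rho\sim_i\rho'$ has $r'$ as the result of its $i$-th premise, the rule with premises $c_1\Rightarrow r_1,\dots,c_{i-1}\Rightarrow r_{i-1},\,c_i\Rightarrow r'$ and conclusion $c\Rightarrow\mathsf{wrong}$; * *propagation rules*: for $\rho\in\mathcal R$ as above, $1\le i\le n$ and $x\in\{\mathsf{wrong},\infty\}$, the rule with premises $c_1\Rightarrow r_1,\dots,c_{i-1}\Rightarrow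 r_{i-1},\,c_i\Rightarrow x$ and conclusion $c\Rightarrow x$. Its corules are the coaxioms $c\Rightarrow\infty$, one for each $c\in C$. Below, "derivable" means derivable in $\mathcal R_{\mathrm{tot}}$ with these corules. **Corollary.** Let $(C,R,\mathcal R)$ be a big-step semantics. For every configuration $c\in C$, at least one of the following holds: * $c\Rightarrow r$ is derivable for some $r\in R$; * $c\Rightarrow\infty$ is derivable; * $c\Rightarrow\mathsf{wrong}$ is derivable. These cases are not mutually exclusive in general: there are a big-step semantics and a configuration $c$ of it for which all three hold at once. -/

import Mathlib

/-! ## Inference systems and corules -/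

/-- An inference system on a universe `U` of judgements: a set of pairs
(set of premises, conclusion). -/
abbrev InferenceSystem (U : Type*) := Set (Set U × U)

namespace InferenceSystem

/-- `I.IndDerivable j`: the judgement `j` has a well-founded proof tree in `I`. -/
inductive IndDerivable {U : Type*} (I : InferenceSystem U) : U → Prop
  | intro (prems : Set U) (concl : U) (rule_mem : (prems, concl) ∈ I)
      (derivable : ∀ j ∈ prems, IndDerivable I j) : IndDerivable I concl

/-- The inductive interpretation. -/
def Ind {U : Type*} (I : InferenceSystem U) : Set U := {j | I.IndDerivable j}

/-- `X` is `I`-consistent: every judgement in `X` is the conclusion of a rule whose premises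
all lie in `X`. -/
def Consistent {U : Type*} (I : InferenceSystem U) (X : Set U) : Prop :=
  ∀ j ∈ X, ∃ prems : Set U, (prems, j) ∈ I ∧ prems ⊆ X

/-- The coinductive interpretation: the largest consistent set, that is, the judgements having an
arbitrary (well-founded or not) proof tree. -/
def CoInd {U : Type*} (I : InferenceSystem U) : Set U := ⋃₀ {X | I.Consistent X}

/-- The rules of `I` whose conclusion lies in `X`. -/
def restrict {U : Type*} (I : InferenceSystem U) (X : Set U) : InferenceSystem U :=
  {q ∈ I | q.2 ∈ X}

/-- The interpretation of the inference system with corules `(I, K)`: the coinductive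
interpretation of `I` restricted to the conclusions that are inductively derivable in `I ∪ K`. -/
def FlexCo {U : Type*} (I K : InferenceSystem U) : Set U :=
  CoInd (restrict I (Ind (I ∪ K)))

end InferenceSystem

/-! ## Big-step semantics -/

namespace BigStep

/-- The judgement `conf ⇒ res`. -/
structure Judgement (C R : Type*) where
  conf : C
  res : R

/-- A big-step rule: a finite sequence of premises and a conclusion. -/
structure Rule (C R : Type*) where
  prems : List (Judgement C R)
  concl : Judgement C R

/-- Change of the set of results along `f`. -/
def Judgement.map {C R R' : Type*} (f : R → R') (j : Judgement C R) : Judgement C R' :=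
  ⟨j.conf, f j.res⟩

/-- Change of the set of results along `f`, in all judgements of a rule. -/
def Rule.map {C R R' : Type*} (f : R → R') (ρ : Rule C R) : Rule C R' :=
  ⟨ρ.prems.map (Judgement.map f), ρ.concl.map f⟩

/-- The inference system obtained by forgetting order and multiplicity of premises. -/
def toInferenceSystem {C R : Type*} (rules : Set (Rule C R)) :
    InferenceSystem (Judgement C R) :=
  {q | ∃ ρ ∈ rules, q = ({j | j ∈ ρ.prems}, ρ.concl)}

/-- A big-step semantics with configurations `C` and results `R`: a set of big-step rules such
that the number of premises is bounded for each configuration in the conclusion. -/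
structure Semantics (C R : Type*) where
  rules : Set (Rule C R)
  bounded_premises : ∀ c : C, ∃ b : ℕ, ∀ ρ ∈ rules, ρ.concl.conf = c → ρ.prems.length ≤ b

/-- Equality of rules up to an index (indices start from `0`): same configuration in the
conclusion, same premises before position `i`, same configuration in the premise at position `i`.
-/
def Rule.EqUpTo {C R : Type*} (ρ ρ' : Rule C R) (i : ℕ)
    (h : i < ρ.prems.length) (h' : i < ρ'.prems.length) : Prop :=
  ρ.concl.conf = ρ'.concl.conf ∧
  (∀ (k : ℕ) (hk : k < i), ρ.prems[k] = ρ'.prems[k]) ∧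
  ρ.prems[i].conf = ρ'.prems[i].conf

/-- The rule with the premises of `ρ` before position `i` (with results embedded along `f`), a last
premise evaluating the configuration of the premise of `ρ` at position `i` to `last`, and a
conclusion evaluating the configuration of `ρ` to `out`. -/
def Rule.cut {C R R' : Type*} (f : R → R') (ρ : Rule C R) (i : ℕ) (h : i < ρ.prems.length)
    (last out : R') : Rule C R' :=
  ⟨(ρ.prems.take i).map (Judgement.map f) ++ [⟨ρ.prems[i].conf, last⟩], ⟨ρ.concl.conf, out⟩⟩

/-- Results extended with `wrong`. -/
inductive WrRes (R : Type*)
  | res (r : R)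
  | wrong

/-- Results extended with divergence `∞`. -/
inductive InfRes (R : Type*)
  | res (r : R)
  | div

/-- Results extended with both `wrong` and `∞`. -/
inductive TotRes (R : Type*)
  | res (r : R)
  | wrong
  | div

/-- The inclusion of `R + {wrong}` in `R + {wrong} + {∞}`. -/
def WrRes.toTot {R : Type*} : WrRes R → TotRes R
  | .res r => .res r
  | .wrong => .wrong

/-- The inclusion of `R + {∞}` in `R + {wrong} + {∞}`. -/
def InfRes.toTot {R : Type*} : InfRes R → TotRes R
  | .res r => .res r
  | .div => .div

namespace Semantics

/-- The rules of the `wrong` construction. -/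
inductive IsWrRule {C R : Type*} (S : Semantics C R) : Rule C (WrRes R) → Prop
  /-- The original rules. -/
  | original (ρ : Rule C R) (hρ : ρ ∈ S.rules) : IsWrRule S (ρ.map WrRes.res)
  /-- Wrong configuration rules. -/
  | wrongConf (c : C) (hc : ∀ ρ ∈ S.rules, ρ.concl.conf ≠ c) : IsWrRule S ⟨[], ⟨c, .wrong⟩⟩
  /-- Wrong result rules. -/
  | wrongRes (ρ : Rule C R) (hρ : ρ ∈ S.rules) (i : ℕ) (h : i < ρ.prems.length) (r : R)
      (hr : ∀ ρ' ∈ S.rules, ∀ h' : i < ρ'.prems.length,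
        ρ.EqUpTo ρ' i h h' → ρ'.prems[i].res ≠ r) :
      IsWrRule S (ρ.cut WrRes.res i h (.res r) .wrong)
  /-- `wrong` propagation rules. -/
  | prop (ρ : Rule C R) (hρ : ρ ∈ S.rules) (i : ℕ) (h : i < ρ.prems.length) :
      IsWrRule S (ρ.cut WrRes.res i h .wrong .wrong)

/-- The set of rules of the `wrong` construction. -/
def wrRules {C R : Type*} (S : Semantics C R) : Set (Rule C (WrRes R)) := {ρ | S.IsWrRule ρ}

/-- The rules of the divergence construction. -/
inductive IsInfRule {C R : Type*} (S : Semantics C R) : Rule C (InfRes R) → Prop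
  /-- The original rules. -/
  | original (ρ : Rule C R) (hρ : ρ ∈ S.rules) : IsInfRule S (ρ.map InfRes.res)
  /-- Divergence propagation rules. -/
  | prop (ρ : Rule C R) (hρ : ρ ∈ S.rules) (i : ℕ) (h : i < ρ.prems.length) :
      IsInfRule S (ρ.cut InfRes.res i h .div .div)

/-- The set of rules of the divergence construction. -/
def infRules {C R : Type*} (S : Semantics C R) : Set (Rule C (InfRes R)) := {ρ | S.IsInfRule ρ}

end Semantics

/-- The coaxioms for divergence, one for each configuration. -/
def divCoaxioms (C R : Type*) : Set (Rule C (InfRes R)) :=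
  {ρ | ∃ c : C, ρ = ⟨[], ⟨c, .div⟩⟩}

namespace Semantics

/-- The rules of the total semantics: the union of the rules of the two constructions. -/
def totRules {C R : Type*} (S : Semantics C R) : Set (Rule C (TotRes R)) :=
  Rule.map WrRes.toTot '' S.wrRules ∪ Rule.map InfRes.toTot '' S.infRules

/-- `S.TotDerives c x`: the judgement `c ⇒ x` is derivable in the total semantics, that is, in the
inference system with corules given by the total rules and the coaxioms for divergence. -/
def TotDerives {C R : Type*} (S : Semantics C R) (c : C) (x : TotRes R) : Prop :=
  (⟨c, x⟩ : Judgement C (TotRes R)) ∈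
    InferenceSystem.FlexCo (toInferenceSystem S.totRules)
      (toInferenceSystem (Rule.map InfRes.toTot '' divCoaxioms C R))

end Semantics

end BigStep

/-!
Write `D` for the set of derivable judgements of the total semantics. By the coinduction principle
`InferenceSystem.subset_flexCo`, `D` is closed under the total rules, and a set of judgements
`c ⇒ ∞` lies in `D` as soon as each member is the conclusion of a total rule whose premises lie in
the set or in `D`: the coaxioms make the inductive side condition trivial for these judgements.

Apply this to the set of all `c ⇒ ∞` with `c` stuck, i.e. deriving neither a result nor `wrong`.
For such a `c`, some rule has `c` in its conclusion, or `c ⇒ wrong` would be an axiom. Among the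
rules for `c`, choose one with the longest initial segment of derivable premises; it exists since
the number of premises of the rules for `c` is bounded. The segment is proper, or `c` would derive
a result. By maximality, and because `c` does not derive `wrong`, the configuration `c'` of the
next premise is again stuck: a result of `c'` would either extend the segment for another rule or
trigger a wrong result rule, and `c' ⇒ wrong` would propagate. So divergence propagation yields
`c ⇒ ∞` from derivable premises and the judgement `c' ⇒ ∞` of the same set
(`BigStep.Semantics.exists_stuck_premise`).

For the overlap, one configuration `c` with the axiom `c ⇒ true` and a rule with sole premise
`c ⇒ false` suffices: `c ⇒ ∞` propagates to itself, and the derivable judgement `c ⇒ true` does not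
fit the premise of any rule.
-/

namespace InferenceSystem

variable {U : Type*} {I K : InferenceSystem U}

theorem flexCo_subset_ind : FlexCo I K ⊆ Ind (I ∪ K) := by
  rintro j ⟨X, hX, hj⟩
  obtain ⟨P, hP, -⟩ := hX j hj
  exact hP.2

theorem consistent_flexCo : Consistent I (FlexCo I K) := by
  rintro j ⟨X, hX, hj⟩
  obtain ⟨P, hP, hPX⟩ := hX j hj
  exact ⟨P, hP.1, fun k hk => ⟨X, hX, hPX hk⟩⟩

/-- Coinduction for inference systems with corules; premises may also be taken from the
interpretation itself. -/
theorem subset_flexCo {X : Set U} (hInd : X ⊆ Ind (I ∪ K))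
    (hX : ∀ j ∈ X, ∃ P : Set U, (P, j) ∈ I ∧ P ⊆ X ∪ FlexCo I K) : X ⊆ FlexCo I K := by
  intro j hj
  refine ⟨X ∪ FlexCo I K, ?_, Or.inl hj⟩
  rintro k (hk | hk)
  · obtain ⟨P, hP, hPX⟩ := hX k hk
    exact ⟨P, ⟨hP, hInd hk⟩, hPX⟩
  · obtain ⟨P, hP, hPX⟩ := consistent_flexCo k hk
    exact ⟨P, ⟨hP, flexCo_subset_ind hk⟩, hPX.trans Set.subset_union_right⟩

theorem mem_flexCo_of_rule {P : Set U} {j : U} (h : (P, j) ∈ I) (hP : P ⊆ FlexCo I K) :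
    j ∈ FlexCo I K := by
  refine subset_flexCo (X := {j}) ?_ ?_ rfl
  · rintro _ rfl
    exact .intro P _ (Or.inl h) fun k hk => flexCo_subset_ind (hP hk)
  · rintro _ rfl
    exact ⟨P, h, hP.trans Set.subset_union_right⟩

end InferenceSystem

namespace BigStep

variable {C R R' R'' : Type*}

theorem Rule.map_map (g : R' → R'') (f : R → R') (ρ : Rule C R) :
    (ρ.map f).map g = ρ.map (g ∘ f) := by
  simp [Rule.map, Judgement.map, Function.comp_def]

theorem Rule.map_cut (g : R' → R'') (f : R → R') (ρ : Rule C R) (i : ℕ) (h : i < ρ.prems.length)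
    (last out : R') : (ρ.cut f i h last out).map g = ρ.cut (g ∘ f) i h (g last) (g out) := by
  simp [Rule.map, Rule.cut, Judgement.map, Function.comp_def]
  rfl

namespace Semantics

variable {S : Semantics C R}

theorem map_res_mem_totRules {ρ : Rule C R} (hρ : ρ ∈ S.rules) :
    ρ.map TotRes.res ∈ S.totRules :=
  Or.inl ⟨_, .original ρ hρ, Rule.map_map _ _ ρ⟩

theorem wrongConf_mem_totRules {c : C} (hc : ∀ ρ ∈ S.rules, ρ.concl.conf ≠ c) :
    ⟨[], ⟨c, .wrong⟩⟩ ∈ S.totRules :=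
  Or.inl ⟨_, .wrongConf c hc, rfl⟩

theorem cut_wrongRes_mem_totRules {ρ : Rule C R} (hρ : ρ ∈ S.rules) {i : ℕ}
    (h : i < ρ.prems.length) {r : R}
    (hr : ∀ ρ' ∈ S.rules, ∀ h' : i < ρ'.prems.length,
      ρ.EqUpTo ρ' i h h' → ρ'.prems[i].res ≠ r) :
    ρ.cut TotRes.res i h (.res r) .wrong ∈ S.totRules :=
  Or.inl ⟨_, .wrongRes ρ hρ i h r hr, Rule.map_cut _ _ ρ i h _ _⟩

theorem cut_wrong_mem_totRules {ρ : Rule C R} (hρ : ρ ∈ S.rules) {i : ℕ}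
    (h : i < ρ.prems.length) : ρ.cut TotRes.res i h .wrong .wrong ∈ S.totRules :=
  Or.inl ⟨_, .prop ρ hρ i h, Rule.map_cut _ _ ρ i h _ _⟩

theorem cut_div_mem_totRules {ρ : Rule C R} (hρ : ρ ∈ S.rules) {i : ℕ}
    (h : i < ρ.prems.length) : ρ.cut TotRes.res i h .div .div ∈ S.totRules :=
  Or.inr ⟨_, .prop ρ hρ i h, Rule.map_cut _ _ ρ i h _ _⟩

theorem totDerives_of_rule {ρ : Rule C (TotRes R)} (hρ : ρ ∈ S.totRules)
    (h : ∀ j ∈ ρ.prems, S.TotDerives j.conf j.res) : S.TotDerives ρ.concl.conf ρ.concl.res :=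
  InferenceSystem.mem_flexCo_of_rule ⟨ρ, hρ, rfl⟩ h

theorem totDerives_cut {ρ : Rule C R} {i : ℕ} {h : i < ρ.prems.length} {last out : TotRes R}
    (hρ : ρ.cut TotRes.res i h last out ∈ S.totRules)
    (hpre : ∀ j ∈ ρ.prems.take i, S.TotDerives j.conf (.res j.res))
    (hlast : S.TotDerives ρ.prems[i].conf last) : S.TotDerives ρ.concl.conf out := by
  refine totDerives_of_rule hρ fun j hj => ?_
  rcases List.mem_append.1 hj with hj | hj
  · obtain ⟨k, hk, rfl⟩ := List.mem_map.1 hj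
    exact hpre k hk
  · obtain rfl := List.mem_singleton.1 hj
    exact hlast

/-- Coinduction for divergence. The coaxioms discharge the inductive side condition, so only a
propagation step for each configuration of the set is needed. -/
theorem totDerives_div_of_coinduction {X : Set C}
    (hX : ∀ c ∈ X, ∃ ρ ∈ S.rules, ρ.concl.conf = c ∧ ∃ i, ∃ h : i < ρ.prems.length,
      (∀ j ∈ ρ.prems.take i, S.TotDerives j.conf (.res j.res)) ∧ ρ.prems[i].conf ∈ X)
    {c : C} (hc : c ∈ X) : S.TotDerives c .div := by
  refine InferenceSystem.subset_flexCo (X := (fun c => ⟨c, .div⟩) '' X) ?_ ?_ ⟨c, hc, rfl⟩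
  · rintro _ ⟨c, -, rfl⟩
    exact .intro _ _ (Or.inr ⟨_, ⟨_, ⟨c, rfl⟩, rfl⟩, rfl⟩) fun j hj => by
      simp [Rule.map] at hj
  · rintro _ ⟨c, hc, rfl⟩
    obtain ⟨ρ, hρ, rfl, i, h, hpre, hi⟩ := hX c hc
    refine ⟨_, ⟨_, cut_div_mem_totRules hρ h, rfl⟩, fun j hj => ?_⟩
    rcases List.mem_append.1 hj with hj | hj
    · obtain ⟨k, hk, rfl⟩ := List.mem_map.1 hj
      exact Or.inr (hpre k hk)
    · obtain rfl := List.mem_singleton.1 hj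
      exact Or.inl ⟨_, hi, rfl⟩

/-- A configuration is stuck if it derives neither a result nor `wrong` in the total semantics. -/
def Stuck (S : Semantics C R) (c : C) : Prop :=
  (∀ r : R, ¬ S.TotDerives c (.res r)) ∧ ¬ S.TotDerives c .wrong

/-- Evaluation of a stuck configuration can proceed along some rule until it reaches a stuck
premise. -/
theorem exists_stuck_premise {c : C} (hc : S.Stuck c) :
    ∃ ρ ∈ S.rules, ρ.concl.conf = c ∧ ∃ i, ∃ h : i < ρ.prems.length,
      (∀ j ∈ ρ.prems.take i, S.TotDerives j.conf (.res j.res)) ∧ S.Stuck ρ.prems[i].conf := by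
  classical
  -- `p i`: some rule for `c` has at least `i` premises, the first `i` of which are derivable.
  let p : ℕ → Prop := fun i => ∃ ρ ∈ S.rules, ρ.concl.conf = c ∧ i ≤ ρ.prems.length ∧
    ∀ j ∈ ρ.prems.take i, S.TotDerives j.conf (.res j.res)
  have hp0 : p 0 := by
    by_contra h
    refine hc.2 (totDerives_of_rule (wrongConf_mem_totRules fun ρ hρ hρc => h ?_) (by simp))
    exact ⟨ρ, hρ, hρc, Nat.zero_le _, by simp⟩
  obtain ⟨b, hb⟩ := S.bounded_premises c
  have hpb : ∀ i, p i → i ≤ b := by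
    rintro i ⟨ρ, hρ, hρc, hi, -⟩
    exact hi.trans (hb ρ hρ hρc)
  obtain ⟨i, ⟨ρ, hρ, rfl, hi, hpre⟩, hmax⟩ : ∃ i, p i ∧ ¬ p (i + 1) := by
    by_contra! h
    have hall : ∀ i, p i := fun i => Nat.rec hp0 h i
    exact absurd (hpb _ (hall (b + 1))) (by omega)
  have hlt : i < ρ.prems.length := by
    refine lt_of_le_of_ne hi fun hi => ?_
    refine hc.1 ρ.concl.res (totDerives_of_rule (map_res_mem_totRules hρ) fun j hj => ?_)
    obtain ⟨k, hk, rfl⟩ := List.mem_map.1 hj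
    exact hpre k (by rwa [hi, List.take_length])
  refine ⟨ρ, hρ, rfl, i, hlt, hpre, fun r hr => ?_, fun hw => ?_⟩
  · refine hc.2 (totDerives_cut (cut_wrongRes_mem_totRules hρ hlt ?_) hpre hr)
    -- A rule agreeing with `ρ` before position `i` and expecting `r` there contradicts maximality.
    rintro ρ' hρ' h' ⟨hconf, heq, hi'⟩ rfl
    refine hmax ⟨ρ', hρ', hconf.symm, h', fun j hj => ?_⟩
    have htake : ρ'.prems.take i = ρ.prems.take i :=
      List.ext_getElem (by simp [h'.le, hlt.le]) fun k hk _ => by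
        have hk : k < i := (List.length_take_le _ _).trans_lt' hk
        simpa using (heq k hk).symm
    rw [List.take_succ_eq_append_getElem h', htake, List.mem_append, List.mem_singleton] at hj
    rcases hj with hj | rfl
    · exact hpre j hj
    · rwa [← hi']
  · exact hc.2 (totDerives_cut (cut_wrong_mem_totRules hρ hlt) hpre hw)

theorem totDerives_div_of_stuck {c : C} (hc : S.Stuck c) : S.TotDerives c .div :=
  totDerives_div_of_coinduction (X := {c | S.Stuck c}) (fun _ hc => exists_stuck_premise hc) hc

/-- The semantics with a single configuration `c` and two rules: the axiom `c ⇒ true`, and the rule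
with premise `c ⇒ false` and conclusion `c ⇒ true`. -/
def overlap : Semantics Unit Bool where
  rules := {⟨[], ⟨(), true⟩⟩, ⟨[⟨(), false⟩], ⟨(), true⟩⟩}
  bounded_premises _ := ⟨1, by simp⟩

theorem overlap_totDerives_true : overlap.TotDerives () (.res true) :=
  totDerives_of_rule (ρ := Rule.map TotRes.res ⟨[], ⟨(), true⟩⟩)
    (map_res_mem_totRules (Or.inl rfl)) (by simp [Rule.map])

theorem overlap_totDerives_div : overlap.TotDerives () .div :=
  totDerives_div_of_coinduction (X := Set.univ)
    (fun _ _ => ⟨_, Or.inr rfl, rfl, 0, by simp, by simp, trivial⟩) trivial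

theorem overlap_totDerives_wrong : overlap.TotDerives () .wrong := by
  refine totDerives_cut (ρ := ⟨[⟨(), false⟩], ⟨(), true⟩⟩) (i := 0) (h := by simp)
    (cut_wrongRes_mem_totRules (Or.inr rfl) _ ?_) (by simp) overlap_totDerives_true
  rintro ρ' (rfl | rfl) h' - <;> simp at h' ⊢

end Semantics

end BigStep

/-- In the total semantics, every configuration of every big-step semantics derives a result, or
`∞`, or `wrong`; and these three possibilities are not mutually exclusive in general. -/
theorem mainTheorem8 :
    (∀ {C R : Type*} (S : BigStep.Semantics C R) (c : C),
      (∃ r : R, S.TotDerives c (.res r)) ∨ S.TotDerives c .div ∨ S.TotDerives c .wrong) ∧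
    (∃ (C R : Type) (S : BigStep.Semantics C R) (c : C),
      (∃ r : R, S.TotDerives c (.res r)) ∧ S.TotDerives c .div ∧ S.TotDerives c .wrong) := by
  refine ⟨fun S c => ?_, Unit, Bool, .overlap, (), ⟨true, ?_⟩, ?_, ?_⟩
  · by_contra! h
    exact h.2.1 (BigStep.Semantics.totDerives_div_of_stuck ⟨h.1, h.2.2⟩)
  · exact BigStep.Semantics.overlap_totDerives_true
  · exact BigStep.Semantics.overlap_totDerives_div
  · exact BigStep.Semantics.overlap_totDerives_wrong
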